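/- **Setting.** Let $n \ge 1$ and let $\mathfrak S_n$ be the symmetric group on $\{1,\dots,n\}$, with $s_{ij}$ the transposition of $i$ and $j$ and $s_i = s_{i,i+1}$. A reduced expression for $u\in\mathfrak S_n$ is a factorization of $u$ into simple transpositions of minimum length. Let $w_0$ be the longest element, $w_0(i)=n+1-i$. The Fomin–Kirillov algebra $\mathcal E_n$ is the associative $\mathbb C$-algebra generated by $x_{ij}=-x_{ji}$ ($i\neq j$ in $\{1,\dots,n\}$) with the relations, for distinct $i,j,k,l$, $$x_{ij}^2=0,\qquad x_{ij}x_{kl}=x_{kl}x_{ij},\qquad x_{ij}x_{jk}+x_{jk}x_{ki}+x_{ki}x_{ij}=0.$$ The group $\mathfrak S_n$ acts on $\mathcal E_n$ by algebra automorphisms with $u(x_{ij})=x_{u(i)u(j)}$. Let $\mathcal E_n^+$ be the set of linear combinations with nonnegative real coefficients of monomials in the variables $x_{ij}$ with $i<j$. For $v,w\in\mathfrak S_n$ and a reduced expression $w=s_{a_1}\cdots s_{a_m}$, the element $x_{w/v}\in\mathcal E_n$ is defined by $$x_{w/v}=v^{-1}\sum_{I}\varphi_1(I)\cdots\varphi_m(I),\qquad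 \varphi_j(I)=\begin{cases}s_{a_j}, & j\in I,\\ x_{a_j,a_j+1}, & j\notin I,\end{cases}$$ where $I$ ranges over all subsets of $\{1,\dots,m\}$ such that $\prod_{j\in I}s_{a_j}$ (factors in increasing order of $j$) is a reduced expression for $v$; the products are formed in the algebra generated by $\mathcal E_n$ and $\mathfrak S_n$ with the commutation rule $x_{ij}\,u=u\,x_{u^{-1}(i)u^{-1}(j)}$, and the result lies in $\mathcal E_n$. **Corollary 3.6.** Let $v,w\in\mathfrak S_n$, let $x_{w/v}$ be computed from any reduced expression for $w$, and let $w_0v=s_{i_1}\cdots s_{i_\ell}$ be any reduced expression. Put $w_k=s_{i_k}s_{i_{k+1}}\cdots s_{i_\ell}$ (so $w_{\ell+1}=\mathrm{id}$) and $y_k=w_{k+1}^{-1}(x_{i_k,i_k+1})$ for $1\le k\le \ell$. Then $y_k\in\mathcal E_n^+$ for every $k$, and $$x_{w/v}=\sum_J\ \prod_{k\notin J}y_k,$$ where the factors are taken in increasing order of $k$ and $J$ ranges over all subsets of $\{1,\dots,\ell\}$ such that $\prod_{k\in J}s_{i_k}$ (in increasing order of $k$) is a reduced expression for $w_0w$.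 In particular, $x_{w/v}$ is a linear combination with nonnegative coefficients of monomials in the variables $x_{ij}$ with $i<j$, in each of which no variable is repeated. -/

import Mathlib

/-! Permutations of `{0, …, n}` are `Equiv.Perm (Fin (n + 1))`, so `n + 1` is the size of the
symmetric group, and the simple transpositions are indexed by `Fin n`. -/

open scoped NNReal

noncomputable section

/-- The defining relations of the Fomin–Kirillov algebra, on generators `x_{ij}` indexed by all
ordered pairs. The generators `x_{ii}`, which are not present in the usual description, are killed
by `diag`. -/
inductive FKRel (m : ℕ) :
    FreeAlgebra ℂ (Fin m × Fin m) → FreeAlgebra ℂ (Fin m × Fin m) → Prop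
  | diag (i : Fin m) : FKRel m (FreeAlgebra.ι ℂ (i, i)) 0
  | antisymm (i j : Fin m) (hij : i ≠ j) :
      FKRel m (FreeAlgebra.ι ℂ (i, j)) (-FreeAlgebra.ι ℂ (j, i))
  | sq (i j : Fin m) (hij : i ≠ j) :
      FKRel m (FreeAlgebra.ι ℂ (i, j) * FreeAlgebra.ι ℂ (i, j)) 0
  | comm (i j k l : Fin m) (hij : i ≠ j) (hik : i ≠ k) (hil : i ≠ l) (hjk : j ≠ k) (hjl : j ≠ l)
      (hkl : k ≠ l) :
      FKRel m (FreeAlgebra.ι ℂ (i, j) * FreeAlgebra.ι ℂ (k, l))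
        (FreeAlgebra.ι ℂ (k, l) * FreeAlgebra.ι ℂ (i, j))
  | cyc (i j k : Fin m) (hij : i ≠ j) (hjk : j ≠ k) (hik : i ≠ k) :
      FKRel m (FreeAlgebra.ι ℂ (i, j) * FreeAlgebra.ι ℂ (j, k)
        + FreeAlgebra.ι ℂ (j, k) * FreeAlgebra.ι ℂ (k, i)
        + FreeAlgebra.ι ℂ (k, i) * FreeAlgebra.ι ℂ (i, j)) 0

/-- The Fomin–Kirillov algebra on `m` indices. -/
abbrev FK (m : ℕ) : Type := RingQuot (FKRel m)

namespace FK

/-- The generator `x_{ij}`. -/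
def x {m : ℕ} (i j : Fin m) : FK m := RingQuot.mkAlgHom ℂ (FKRel m) (FreeAlgebra.ι ℂ (i, j))

/-- The algebra endomorphism `x_{ij} ↦ x_{w(i) w(j)}`. -/
def act {m : ℕ} (w : Equiv.Perm (Fin m)) : FK m →ₐ[ℂ] FK m :=
  RingQuot.liftAlgHom ℂ ⟨FreeAlgebra.lift ℂ (fun p => x (w p.1) (w p.2)), by
    intro a b h
    induction h with
    | diag i =>
      simpa [x] using RingQuot.mkAlgHom_rel ℂ (FKRel.diag (w i))
    | antisymm i j hij =>
      simpa [x] using RingQuot.mkAlgHom_rel ℂ (FKRel.antisymm (w i) (w j) (by simpa using hij))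
    | sq i j hij =>
      simpa [x] using RingQuot.mkAlgHom_rel ℂ (FKRel.sq (w i) (w j) (by simpa using hij))
    | comm i j k l hij hik hil hjk hjl hkl =>
      simpa [x] using RingQuot.mkAlgHom_rel ℂ (FKRel.comm (w i) (w j) (w k) (w l)
        (by simpa using hij) (by simpa using hik) (by simpa using hil) (by simpa using hjk)
        (by simpa using hjl) (by simpa using hkl))
    | cyc i j k hij hjk hik =>
      simpa [x] using RingQuot.mkAlgHom_rel ℂ (FKRel.cyc (w i) (w j) (w k)
        (by simpa using hij) (by simpa using hjk) (by simpa using hik))⟩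

theorem act_x {m : ℕ} (w : Equiv.Perm (Fin m)) (i j : Fin m) : act w (x i j) = x (w i) (w j) := by
  simp [act, x, RingQuot.liftAlgHom_mkAlgHom_apply]

theorem act_one {m : ℕ} : act (1 : Equiv.Perm (Fin m)) = AlgHom.id ℂ (FK m) := by
  apply RingQuot.ringQuot_ext'
  ext p
  exact act_x 1 p.1 p.2

theorem act_mul {m : ℕ} (v w : Equiv.Perm (Fin m)) : act (v * w) = (act v).comp (act w) := by
  apply RingQuot.ringQuot_ext'
  ext p
  have h1 := act_x (v * w) p.1 p.2
  have h2 : act v (act w (x p.1 p.2)) = x (v (w p.1)) (v (w p.2)) := by rw [act_x, act_x]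
  exact h1.trans h2.symm

/-- The action of the symmetric group by permuting the indices: `w • x_{ij} = x_{w(i) w(j)}`. -/
instance instAction (m : ℕ) : MulSemiringAction (Equiv.Perm (Fin m)) (FK m) where
  smul w a := act w a
  one_smul a := by change act 1 a = a; rw [act_one]; rfl
  mul_smul v w a := by change act (v * w) a = act v (act w a); rw [act_mul]; rfl
  smul_zero w := map_zero (act w)
  smul_add w := map_add (act w)
  smul_one w := map_one (act w)
  smul_mul w := map_mul (act w)

/-- The positive span of the monomials in the variables `x_{ij}` with `i < j`. -/
def positive (m : ℕ) : Submodule ℝ≥0 (FK m) :=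
  Submodule.span ℝ≥0 (Submonoid.closure {a : FK m | ∃ i j : Fin m, i < j ∧ a = x i j} : Set (FK m))

/-- The positive span of those monomials in the variables `x_{ij}` with `i < j` in which no variable
is repeated. -/
def positiveNoRepeat (m : ℕ) : Submodule ℝ≥0 (FK m) :=
  Submodule.span ℝ≥0 {a : FK m | ∃ l : List (Fin m × Fin m),
    l.Nodup ∧ (∀ p ∈ l, p.1 < p.2) ∧ a = (l.map fun p => x p.1 p.2).prod}

end FK

/-- The simple transposition exchanging `i` and `i + 1`. -/
def simpleTransposition {n : ℕ} (i : Fin n) : Equiv.Perm (Fin (n + 1)) :=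
  Equiv.swap i.castSucc i.succ

/-- The product of the simple transpositions named by a word. -/
def wordProd {n : ℕ} (a : List (Fin n)) : Equiv.Perm (Fin (n + 1)) :=
  (a.map simpleTransposition).prod

/-- `a` is a reduced expression for `w`: a factorization of `w` into simple transpositions of
minimum length. -/
def IsReducedWord {n : ℕ} (a : List (Fin n)) (w : Equiv.Perm (Fin (n + 1))) : Prop :=
  wordProd a = w ∧ ∀ b : List (Fin n), wordProd b = w → a.length ≤ b.length

/-- The subword of `a` formed by the letters at the positions in `J`, in their order in `a`. -/
def subword {n : ℕ} (a : List (Fin n)) (J : Finset (Fin a.length)) : List (Fin n) :=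
  ((List.finRange a.length).filter (· ∈ J)).map a.get

/-- The longest permutation of `Fin (n + 1)`, which is the order reversal. -/
def longestPerm (n : ℕ) : Equiv.Perm (Fin (n + 1)) := Fin.revPerm

/-- The ordered product `φ_J = φ_1 ⋯ φ_ℓ`, where `φ_j` is the permutation `s_{a_j}` for `j ∈ J` and
the variable `x_{a_j, a_j + 1}` for `j ∉ J`. It is formed in the algebra generated by the
Fomin–Kirillov algebra and the symmetric group subject to `w a = (w • a) w`, that is, to
`x_{ij} w = w x_{w⁻¹(i) w⁻¹(j)}`. -/
def phi {n : ℕ} (a : List (Fin n)) (J : Finset (Fin a.length)) :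
    SkewMonoidAlgebra (FK (n + 1)) (Equiv.Perm (Fin (n + 1))) :=
  ((List.finRange a.length).map fun j =>
    if j ∈ J then SkewMonoidAlgebra.single (simpleTransposition (a.get j)) 1
    else SkewMonoidAlgebra.single 1 (FK.x (a.get j).castSucc (a.get j).succ)).prod

open Classical in
/-- `v⁻¹ ∑_J φ_J`, where `J` ranges over the sets of positions at which the word `a` carries a
reduced expression for `v`. -/
def skewSum {n : ℕ} (a : List (Fin n)) (v : Equiv.Perm (Fin (n + 1))) :
    SkewMonoidAlgebra (FK (n + 1)) (Equiv.Perm (Fin (n + 1))) :=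
  SkewMonoidAlgebra.single v⁻¹ 1 *
    ∑ J ∈ Finset.univ.filter (fun J : Finset (Fin a.length) => IsReducedWord (subword a J) v),
      phi a J

/-- The element `x_{w/v}` of the Fomin–Kirillov algebra, computed from the reduced expression `a`
for `w`: it is `v⁻¹ ∑_J φ_J`, which lies in the Fomin–Kirillov algebra (`single_one_skew`). -/
def skew {n : ℕ} (a : List (Fin n)) (v : Equiv.Perm (Fin (n + 1))) : FK (n + 1) :=
  (skewSum a v).coeff 1

theorem phi_eq_single {n : ℕ} (a : List (Fin n)) (J : Finset (Fin a.length)) :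
    ∃ c : FK (n + 1), phi a J = SkewMonoidAlgebra.single (wordProd (subword a J)) c := by
  unfold phi subword wordProd
  induction List.finRange a.length with
  | nil => exact ⟨1, rfl⟩
  | cons j L ih =>
    obtain ⟨c, hc⟩ := ih
    rw [List.map_cons, List.prod_cons, hc]
    by_cases hj : j ∈ J
    · refine ⟨1 * simpleTransposition (a.get j) • c, ?_⟩
      rw [if_pos hj, SkewMonoidAlgebra.single_mul_single,
        List.filter_cons_of_pos (by simpa using hj), List.map_cons, List.map_cons, List.prod_cons]
    · refine ⟨FK.x (a.get j).castSucc (a.get j).succ *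
        (1 : Equiv.Perm (Fin (n + 1))) • c, ?_⟩
      rw [if_neg hj, SkewMonoidAlgebra.single_mul_single, one_mul,
        List.filter_cons_of_neg (by simpa using hj)]

/-- `v⁻¹ ∑_J φ_J` is an element of the Fomin–Kirillov algebra. -/
theorem single_one_skew {n : ℕ} (a : List (Fin n)) (v : Equiv.Perm (Fin (n + 1))) :
    SkewMonoidAlgebra.single 1 (skew a v) = skewSum a v := by
  classical
  suffices h : ∃ c : FK (n + 1), skewSum a v = SkewMonoidAlgebra.single 1 c by
    obtain ⟨c, hc⟩ := h
    simp [skew, hc, SkewMonoidAlgebra.coeff_single]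
  have h : ∀ J : Finset (Fin a.length), IsReducedWord (subword a J) v →
      ∃ c : FK (n + 1),
        SkewMonoidAlgebra.single v⁻¹ 1 * phi a J = SkewMonoidAlgebra.single 1 c := by
    intro J hJ
    obtain ⟨c, hc⟩ := phi_eq_single a J
    rw [hc, hJ.1, SkewMonoidAlgebra.single_mul_single, inv_mul_cancel]
    exact ⟨_, rfl⟩
  choose! c hc using h
  refine ⟨∑ J ∈ Finset.univ.filter
    (fun J : Finset (Fin a.length) => IsReducedWord (subword a J) v), c J, ?_⟩
  rw [skewSum, Finset.mul_sum]
  have h2 := map_sum (SkewMonoidAlgebra.singleAddHom (k := FK (n + 1))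
    (1 : Equiv.Perm (Fin (n + 1)))) c (Finset.univ.filter
    (fun J : Finset (Fin a.length) => IsReducedWord (subword a J) v))
  refine Eq.trans ?_ h2.symm
  refine Finset.sum_congr (by congr) fun J hJ => ?_
  exact hc J (by simpa using hJ)

/-- `y_k = w_{k+1}⁻¹ (x_{b_k, b_k + 1})`, where `w_{k+1}` is the product of the letters of `b` strictly
to the right of position `k`. -/
def yVar {n : ℕ} (b : List (Fin n)) (k : Fin b.length) : FK (n + 1) :=
  (wordProd (b.drop (k + 1)))⁻¹ • FK.x (b.get k).castSucc (b.get k).succ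

/-- The product of the `y_k` with `k ∉ J`, in increasing order of `k`. -/
def yProd {n : ℕ} (b : List (Fin n)) (J : Finset (Fin b.length)) : FK (n + 1) :=
  (((List.finRange b.length).filter (· ∉ J)).map (yVar b)).prod

end

/-! Splitting the sum defining $x_{w/v}$ by whether the first letter of the word is used gives
`skew_cons`: prepending $i$ acts on the function $v\mapsto x_{w/v}$ by the operator `skewStep i`.
These operators satisfy the braid relations (`skewStep_comm`, `skewStep_braid`), so by Matsumoto's
theorem $x_{w/v}$ does not depend on the reduced word (`skew_eq_skew`).

Read backwards, the recursion moves $v$ up towards $w_0$. If $j$ is a left ascent of $v$, then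
$x_{w/v}=x_{s_jw/s_jv}+v^{-1}(x_{j,j+1})\,x_{w/s_jv}$ when $j$ is a left ascent of $w$, and the
first summand is absent otherwise. Since $w_0$ exchanges left ascents and left descents, up to
$i\mapsto n-i$, this is the recursion on the first letter satisfied by the sum over subwords of a
reduced word of $w_0v$. The two sides agree at $v=w_0$, where both are 1 for $w=w_0$ and 0
otherwise.

Positivity holds because the index pairs of the $y_k$ are distinct inversions of $w_0v$. -/

/-! ### Inversions, length and reduced words. -/

/-- The positions `p < q` whose values are exchanged by `w`. -/
def inversions {m : ℕ} (w : Equiv.Perm (Fin m)) : Finset (Fin m × Fin m) :=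
  Finset.univ.filter fun p => p.1 < p.2 ∧ w p.2 < w p.1

/-- `i` is a left ascent of `w` if `i` occurs before `i + 1` in the one-line notation of `w`. -/
def IsLeftAscent {n : ℕ} (i : Fin n) (w : Equiv.Perm (Fin (n + 1))) : Prop :=
  w⁻¹ i.castSucc < w⁻¹ i.succ

theorem mem_inversions {m : ℕ} {w : Equiv.Perm (Fin m)} {p : Fin m × Fin m} :
    p ∈ inversions w ↔ p.1 < p.2 ∧ w p.2 < w p.1 := by
  simp [inversions]

theorem inversions_one {m : ℕ} : inversions (1 : Equiv.Perm (Fin m)) = ∅ := by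
  ext p
  simp only [mem_inversions, Equiv.Perm.one_apply, Finset.notMem_empty, iff_false, not_and, not_lt]
  exact fun h => h.le

section Simple

variable {n : ℕ} (i : Fin n)

@[simp]
theorem simpleTransposition_castSucc : simpleTransposition i i.castSucc = i.succ :=
  Equiv.swap_apply_left _ _

@[simp]
theorem simpleTransposition_succ : simpleTransposition i i.succ = i.castSucc :=
  Equiv.swap_apply_right _ _

@[simp]
theorem simpleTransposition_mul_self : simpleTransposition i * simpleTransposition i = 1 :=
  Equiv.swap_mul_self _ _

@[simp]
theorem simpleTransposition_inv : (simpleTransposition i)⁻¹ = simpleTransposition i :=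
  Equiv.swap_inv _ _

@[simp]
theorem simpleTransposition_mul_cancel_left (w : Equiv.Perm (Fin (n + 1))) :
    simpleTransposition i * (simpleTransposition i * w) = w := by
  rw [← mul_assoc, simpleTransposition_mul_self, one_mul]

theorem simpleTransposition_of_ne {x : Fin (n + 1)} (h1 : x ≠ i.castSucc) (h2 : x ≠ i.succ) :
    simpleTransposition i x = x :=
  Equiv.swap_apply_of_ne_of_ne h1 h2

theorem simpleTransposition_lt {x y : Fin (n + 1)} (hxy : x < y)
    (h : ¬ (x = i.castSucc ∧ y = i.succ)) :
    simpleTransposition i x < simpleTransposition i y := by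
  simp only [simpleTransposition, Equiv.swap_apply_def]
  simp only [Fin.ext_iff, Fin.lt_def, Fin.val_castSucc, Fin.val_succ] at *
  split_ifs <;> (try simp only [Fin.val_castSucc, Fin.val_succ]) <;> omega

theorem wordProd_cons (a : List (Fin n)) :
    wordProd (i :: a) = simpleTransposition i * wordProd a := by
  simp [wordProd]

theorem wordProd_nil : wordProd ([] : List (Fin n)) = 1 := rfl

variable {i} {w : Equiv.Perm (Fin (n + 1))}

theorem not_isLeftAscent : ¬ IsLeftAscent i w ↔ w⁻¹ i.succ < w⁻¹ i.castSucc := by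
  rw [IsLeftAscent, not_lt, le_iff_lt_or_eq, or_iff_left]
  intro h
  simp [Fin.ext_iff] at h

theorem isLeftAscent_simple_mul :
    IsLeftAscent i (simpleTransposition i * w) ↔ ¬ IsLeftAscent i w := by
  rw [not_isLeftAscent, IsLeftAscent, mul_inv_rev, simpleTransposition_inv,
    Equiv.Perm.mul_apply, Equiv.Perm.mul_apply, simpleTransposition_castSucc,
    simpleTransposition_succ]

variable (i w) in
theorem inv_castSucc_inv_succ_notMem_inversions :
    (w⁻¹ i.castSucc, w⁻¹ i.succ) ∉ inversions w := by
  simp [mem_inversions, Fin.castSucc_lt_succ.le]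

/-- Only the values `i` and `i + 1` change their relative order, so only the pair of positions
carrying them changes its status. -/
theorem inversions_simple_mul (h : IsLeftAscent i w) :
    inversions (simpleTransposition i * w) =
      insert (w⁻¹ i.castSucc, w⁻¹ i.succ) (inversions w) := by
  ext ⟨p, q⟩
  simp only [mem_inversions, Finset.mem_insert, Prod.mk.injEq, Equiv.Perm.mul_apply,
    Equiv.Perm.eq_inv_iff_eq]
  by_cases hpq : w p = i.castSucc ∧ w q = i.succ
  · have : p < q := by
      rw [IsLeftAscent, ← hpq.1, ← hpq.2] at h
      simpa using h
    simp [hpq, this]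
  · by_cases hqp : w q = i.castSucc ∧ w p = i.succ
    · have : q < p := by
        rw [IsLeftAscent, ← hqp.1, ← hqp.2] at h
        simpa using h
      simp [hpq, this.not_gt]
    · simp only [hpq, false_or, and_congr_right_iff]
      intro hlt
      rcases lt_or_gt_of_ne (show w p ≠ w q by simpa using hlt.ne) with h1 | h1
      · have := simpleTransposition_lt i h1 hpq
        simp [h1.not_gt, this.not_gt]
      · have := simpleTransposition_lt i h1 hqp
        simp [h1, this]

theorem card_inversions_of_isLeftAscent (h : IsLeftAscent i w) :
    (inversions (simpleTransposition i * w)).card = (inversions w).card + 1 := by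
  rw [inversions_simple_mul h, Finset.card_insert_of_notMem (inv_castSucc_inv_succ_notMem_inversions i w)]

theorem card_inversions_of_not_isLeftAscent (h : ¬ IsLeftAscent i w) :
    (inversions (simpleTransposition i * w)).card + 1 = (inversions w).card := by
  have := card_inversions_of_isLeftAscent (isLeftAscent_simple_mul.2 h)
  simpa using this.symm

theorem card_inversions_wordProd_le (a : List (Fin n)) :
    (inversions (wordProd a)).card ≤ a.length := by
  induction a with
  | nil => simp [wordProd_nil, inversions_one]
  | cons i a ih =>
    rw [wordProd_cons, List.length_cons]
    by_cases h : IsLeftAscent i (wordProd a)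
    · have := card_inversions_of_isLeftAscent h
      omega
    · have := card_inversions_of_not_isLeftAscent h
      omega

/-- Here `w⁻¹` is an increasing bijection, and a finite chain has no order automorphism but the
identity. -/
theorem eq_one_of_forall_isLeftAscent (h : ∀ i, IsLeftAscent i w) : w = 1 := by
  have hmono : StrictMono (w⁻¹ : Equiv.Perm (Fin (n + 1))) := Fin.strictMono_iff_lt_succ.2 h
  have := Subsingleton.elim (hmono.orderIsoOfSurjective _ (Equiv.surjective _)) (OrderIso.refl _)
  rw [← inv_eq_one]
  ext x
  simpa using congrArg (fun e : Fin (n + 1) ≃o Fin (n + 1) => ((e x : Fin (n + 1)) : ℕ)) this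

variable (w) in
theorem exists_wordProd_eq :
    ∃ a : List (Fin n), wordProd a = w ∧ a.length = (inversions w).card := by
  induction hk : (inversions w).card using Nat.strong_induction_on generalizing w with
  | _ k ih =>
    by_cases h : ∀ i, IsLeftAscent i w
    · refine ⟨[], ?_, ?_⟩
      · rw [eq_one_of_forall_isLeftAscent h, wordProd_nil]
      · rw [← hk, eq_one_of_forall_isLeftAscent h, inversions_one]; rfl
    · push Not at h
      obtain ⟨i, hi⟩ := h
      have := card_inversions_of_not_isLeftAscent hi
      obtain ⟨a, ha, hl⟩ := ih _ (by omega) (simpleTransposition i * w) rfl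
      exact ⟨i :: a, by rw [wordProd_cons, ha, simpleTransposition_mul_cancel_left],
        by rw [List.length_cons]; omega⟩

theorem isReducedWord_iff {a : List (Fin n)} :
    IsReducedWord a w ↔ wordProd a = w ∧ a.length = (inversions w).card := by
  constructor
  · rintro ⟨rfl, h⟩
    obtain ⟨b, hb, hl⟩ := exists_wordProd_eq (wordProd a)
    exact ⟨rfl, le_antisymm (hl ▸ h b hb) (card_inversions_wordProd_le a)⟩
  · rintro ⟨rfl, h⟩
    exact ⟨rfl, fun b hb => by rw [h, ← hb]; exact card_inversions_wordProd_le b⟩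

variable (w) in
theorem exists_isReducedWord : ∃ a : List (Fin n), IsReducedWord a w := by
  simpa only [isReducedWord_iff] using exists_wordProd_eq w

theorem isReducedWord_nil : IsReducedWord ([] : List (Fin n)) w ↔ w = 1 := by
  rw [isReducedWord_iff, wordProd_nil]
  constructor
  · exact fun h => h.1.symm
  · rintro rfl
    simp [inversions_one]

/-- Every recursion on words below rests on this criterion: a first letter is admissible exactly
when it is a left descent. -/
theorem isReducedWord_cons {a : List (Fin n)} :
    IsReducedWord (i :: a) w ↔ ¬ IsLeftAscent i w ∧ IsReducedWord a (simpleTransposition i * w) := by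
  simp only [isReducedWord_iff, wordProd_cons, List.length_cons]
  constructor
  · rintro ⟨rfl, h⟩
    rw [simpleTransposition_mul_cancel_left, isLeftAscent_simple_mul, not_not]
    have := card_inversions_wordProd_le a
    by_cases hi : IsLeftAscent i (wordProd a)
    · have := card_inversions_of_isLeftAscent hi
      exact ⟨hi, rfl, by omega⟩
    · have := card_inversions_of_not_isLeftAscent hi
      omega
  · rintro ⟨hi, ha, hl⟩
    have := card_inversions_of_not_isLeftAscent hi
    exact ⟨by rw [ha, simpleTransposition_mul_cancel_left], by omega⟩

theorem IsReducedWord.cons {a : List (Fin n)} (ha : IsReducedWord a w) (h : IsLeftAscent i w) :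
    IsReducedWord (i :: a) (simpleTransposition i * w) := by
  rw [isReducedWord_cons, isLeftAscent_simple_mul, not_not, simpleTransposition_mul_cancel_left]
  exact ⟨h, ha⟩

end Simple

/-! ### Braid relations and Matsumoto's theorem. -/

section Braid

variable {n : ℕ} {i j : Fin n}

theorem simpleTransposition_commute (hij : (i : ℕ) + 1 < j) :
    simpleTransposition i * simpleTransposition j =
      simpleTransposition j * simpleTransposition i := by
  apply Equiv.Perm.Disjoint.commute
  intro x
  by_cases hx : x = i.castSucc ∨ x = i.succ
  · right
    apply simpleTransposition_of_ne <;> rcases hx with rfl | rfl <;> simp [Fin.ext_iff] <;> omega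
  · left
    push Not at hx
    exact simpleTransposition_of_ne i hx.1 hx.2

theorem simpleTransposition_apply_of_lt (hij : (i : ℕ) + 1 < j) :
    simpleTransposition i j.castSucc = j.castSucc ∧ simpleTransposition i j.succ = j.succ ∧
    simpleTransposition j i.castSucc = i.castSucc ∧ simpleTransposition j i.succ = i.succ := by
  refine ⟨?_, ?_, ?_, ?_⟩ <;> apply simpleTransposition_of_ne <;> simp [Fin.ext_iff] <;> omega

theorem simpleTransposition_apply_of_succ (hij : i.succ = j.castSucc) :
    simpleTransposition i j.succ = j.succ ∧ simpleTransposition j i.castSucc = i.castSucc := by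
  simp only [Fin.ext_iff, Fin.val_succ, Fin.val_castSucc] at hij
  refine ⟨?_, ?_⟩ <;> apply simpleTransposition_of_ne <;> simp [Fin.ext_iff] <;> omega

/-- Both sides are the transposition of `i` and `i + 2`. -/
theorem simpleTransposition_braid (hij : i.succ = j.castSucc) :
    simpleTransposition i * (simpleTransposition j * simpleTransposition i) =
      simpleTransposition j * (simpleTransposition i * simpleTransposition j) := by
  have h1 : i.castSucc ≠ i.succ := Fin.castSucc_lt_succ.ne
  have h2 : j.succ ≠ i.succ := hij ▸ Fin.castSucc_lt_succ.ne'
  have h3 : i.castSucc ≠ j.succ := by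
    simp only [Fin.ext_iff, Fin.val_succ, Fin.val_castSucc, ne_eq] at hij ⊢; omega
  have e1 := Equiv.swap_mul_swap_mul_swap h1 h3
  have e2 := Equiv.swap_mul_swap_mul_swap h2 h3.symm
  unfold simpleTransposition
  rw [← hij, ← mul_assoc, ← mul_assoc, e1, Equiv.swap_comm j.succ, ← e2,
    Equiv.swap_comm i.castSucc, Equiv.swap_comm j.succ]

end Braid

/-- Matsumoto's theorem for the symmetric group: operators that satisfy the braid relations have
the same composition along any two reduced words of a permutation. -/
theorem foldr_eq_foldr_of_isReducedWord {n : ℕ} {M : Type*} (T : Fin n → M → M)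
    (hcomm : ∀ i j : Fin n, (i : ℕ) + 1 < j → ∀ f, T i (T j f) = T j (T i f))
    (hbraid : ∀ i j : Fin n, i.succ = j.castSucc → ∀ f, T i (T j (T i f)) = T j (T i (T j f)))
    {a b : List (Fin n)} {w : Equiv.Perm (Fin (n + 1))} (ha : IsReducedWord a w)
    (hb : IsReducedWord b w) (f : M) : a.foldr T f = b.foldr T f := by
  induction hl : a.length using Nat.strong_induction_on generalizing a b w with
  | _ l ih =>
  have hlen {c d : List (Fin n)} {u : Equiv.Perm (Fin (n + 1))} (hc : IsReducedWord c u)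
      (hd : IsReducedWord d u) : c.length = d.length :=
    le_antisymm (hc.2 d hd.1) (hd.2 c hc.1)
  match a, b with
  | [], b => rw [List.eq_nil_of_length_eq_zero (hlen ha hb).symm]
  | a, [] => rw [List.eq_nil_of_length_eq_zero (hlen ha hb)]
  | i :: a, j :: b =>
    clear * - ih ha hb hl hlen hcomm hbraid
    rw [List.length_cons] at hl
    wlog hij : i ≤ j generalizing i j a b
    · refine (this j b i a hb ha ?_ (le_of_not_ge hij)).symm
      have := hlen ha hb
      simp only [List.length_cons] at this
      omega
    have ha' := isReducedWord_cons.1 ha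
    have hb' := isReducedWord_cons.1 hb
    have hlb := hlen ha hb
    simp only [List.length_cons] at hlb
    simp only [List.foldr_cons]
    rcases hij.eq_or_lt with rfl | hlt
    · rw [ih _ (by omega) ha'.2 hb'.2 rfl]
    rw [Fin.lt_def] at hlt
    rcases (Nat.succ_le_of_lt hlt).eq_or_lt with he | hlt
    · have hs : i.succ = j.castSucc := by simp [Fin.ext_iff, ← he]
      obtain ⟨s1, s2⟩ := simpleTransposition_apply_of_succ hs
      -- As `i` and `j = i + 1` are both left descents, `w⁻¹` reverses the order of three
      -- consecutive values, and `w` has reduced words `i j i c` and `j i j c`. Induction compares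
      -- each given tail with one of these, and `hbraid` links the two.
      obtain ⟨c, hc⟩ := exists_isReducedWord
        (simpleTransposition i * (simpleTransposition j * (simpleTransposition i * w)))
      have hd1 := not_isLeftAscent.1 ha'.1
      have hd2 := not_isLeftAscent.1 hb'.1
      have h1 : IsReducedWord (j :: i :: c) (simpleTransposition i * w) := by
        rw [isReducedWord_cons, isReducedWord_cons, not_isLeftAscent, not_isLeftAscent]
        refine ⟨?_, ?_, hc⟩
        · simp only [mul_inv_rev, simpleTransposition_inv, Equiv.Perm.mul_apply, s1, ← hs,
            simpleTransposition_succ]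
          rw [← hs] at hd2
          exact hd2.trans hd1
        · simp only [mul_inv_rev, simpleTransposition_inv, Equiv.Perm.mul_apply, s2]
          rw [hs]
          simp only [simpleTransposition_castSucc, s1]
          simpa [hs] using hd2
      have h2 : IsReducedWord (i :: j :: c) (simpleTransposition j * w) := by
        rw [isReducedWord_cons, isReducedWord_cons, not_isLeftAscent, not_isLeftAscent]
        refine ⟨?_, ?_, ?_⟩
        · simp only [mul_inv_rev, simpleTransposition_inv, Equiv.Perm.mul_apply, s2, hs,
            simpleTransposition_castSucc]
          rw [hs] at hd1
          exact hd2.trans hd1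
        · simp only [mul_inv_rev, simpleTransposition_inv, Equiv.Perm.mul_apply, s1]
          rw [← hs]
          simp only [simpleTransposition_succ, s2]
          simpa [hs] using hd1
        · have := simpleTransposition_braid hs
          simp only [← mul_assoc] at this hc ⊢
          rwa [← this]
      have hl1 := hlen ha'.2 h1
      simp only [List.length_cons] at hl1
      rw [ih _ (by omega) ha'.2 h1 rfl, ih _ (by omega) hb'.2 h2 rfl]
      exact hbraid i j hs _
    · obtain ⟨s1, s2, s3, s4⟩ := simpleTransposition_apply_of_lt hlt
      -- The same argument with the reduced words `i j c` and `j i c` of `w`.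
      obtain ⟨c, hc⟩ := exists_isReducedWord
        (simpleTransposition j * (simpleTransposition i * w))
      have h1 : IsReducedWord (j :: c) (simpleTransposition i * w) := by
        rw [isReducedWord_cons, not_isLeftAscent]
        refine ⟨?_, hc⟩
        simp only [mul_inv_rev, simpleTransposition_inv, Equiv.Perm.mul_apply, s1, s2]
        exact not_isLeftAscent.1 hb'.1
      have h2 : IsReducedWord (i :: c) (simpleTransposition j * w) := by
        rw [isReducedWord_cons, not_isLeftAscent]
        refine ⟨?_, ?_⟩
        · simp only [mul_inv_rev, simpleTransposition_inv, Equiv.Perm.mul_apply, s3, s4]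
          exact not_isLeftAscent.1 ha'.1
        · rwa [← mul_assoc, simpleTransposition_commute hlt, mul_assoc]
      rw [ih _ (by omega) ha'.2 h1 rfl, ih _ (by omega) hb'.2 h2 rfl]
      exact hcomm i j hlt _

/-! ### Consequences of the relations of the Fomin–Kirillov algebra. -/

namespace FK

variable {m : ℕ}

theorem smul_x (w : Equiv.Perm (Fin m)) (i j : Fin m) : w • x i j = x (w i) (w j) :=
  act_x w i j

theorem x_swap {i j : Fin m} (hij : i ≠ j) : x i j = -x j i := by
  simpa [x] using RingQuot.mkAlgHom_rel ℂ (FKRel.antisymm i j hij)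

theorem x_mul_self {i j : Fin m} (hij : i ≠ j) : x i j * x i j = 0 := by
  simpa [x] using RingQuot.mkAlgHom_rel ℂ (FKRel.sq i j hij)

theorem x_comm {i j k l : Fin m} (hij : i ≠ j) (hik : i ≠ k) (hil : i ≠ l) (hjk : j ≠ k)
    (hjl : j ≠ l) (hkl : k ≠ l) : x i j * x k l = x k l * x i j := by
  simpa [x] using RingQuot.mkAlgHom_rel ℂ (FKRel.comm i j k l hij hik hil hjk hjl hkl)

theorem x_add_x_swap {i j : Fin m} (hij : i ≠ j) : x i j + x j i = 0 := by
  rw [x_swap hij]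
  exact neg_add_cancel (x j i)

theorem x_mul_x_swap {i j : Fin m} (hij : i ≠ j) : x i j * x j i = 0 := by
  rw [← zero_add (x i j * x j i), ← x_mul_self hij, ← mul_add, x_add_x_swap hij, mul_zero,
    x_mul_self hij]

/-- The cyclic relation with its signs absorbed by antisymmetry, so that the braid identity can be
checked without subtraction. -/
theorem x_mul_x_add {i j k : Fin m} (hij : i ≠ j) (hjk : j ≠ k) (hik : i ≠ k) :
    x i j * x j k + x i k * x j i = x j k * x i k := by
  have h := RingQuot.mkAlgHom_rel ℂ (FKRel.cyc i j k hij hjk hik)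
  simp only [map_add, map_mul, map_zero] at h
  change x i j * x j k + x j k * x k i + x k i * x i j = 0 at h
  have h1 : x i k * x j i = x k i * x i j := by
    rw [x_swap hik, x_swap hij.symm]
    exact neg_mul_neg (x k i) (x i j)
  have h2 : x j k * x k i + x j k * x i k = 0 := by
    rw [← mul_add, x_add_x_swap hik.symm, mul_zero]
  calc x i j * x j k + x i k * x j i
      = x i j * x j k + x i k * x j i + (x j k * x k i + x j k * x i k) := by rw [h2, add_zero]
    _ = x i j * x j k + x j k * x k i + x k i * x i j + x j k * x i k := by rw [h1]; ac_rfl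
    _ = x j k * x i k := by rw [h, zero_add]

theorem x_mul_x {i j k : Fin m} (hij : i ≠ j) (hjk : j ≠ k) (hik : i ≠ k) :
    x i j * x j k = x j k * x i k + x i k * x i j := by
  rw [← x_mul_x_add hij hjk hik, add_assoc, ← mul_add, x_add_x_swap hij.symm, mul_zero, add_zero]

theorem x_mul_x_of_left {i j k : Fin m} (hij : i ≠ j) (hjk : j ≠ k) (hik : i ≠ k) :
    x i j * x i k = x i k * x k j + x j k * x i j := by
  rw [x_mul_x hik hjk.symm hij, add_right_comm, ← add_mul, x_add_x_swap hjk.symm, zero_mul,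
    zero_add]

/-- Expanding `x i j * x j k` on either side, a square kills one term and leaves `x j k * x i k * x
i j`. -/
theorem x_braid {i j k : Fin m} (hij : i ≠ j) (hjk : j ≠ k) (hik : i ≠ k) :
    x i j * (x j k * x i j) = x j k * (x i j * x j k) := by
  rw [← mul_assoc, x_mul_x hij hjk hik, add_mul, mul_add, ← mul_assoc (x j k) (x j k),
    x_mul_self hjk, mul_assoc (x i k), x_mul_self hij, mul_zero, add_zero, zero_mul, zero_add,
    mul_assoc]

end FK

/-! ### The operators `skewStep` and their braid relations. -/

section

variable {n : ℕ}

/-- The operator by which prepending the letter `i` to a word changes its skew elements: it sends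
`f` to `v ↦ v⁻¹(x_{i, i + 1}) f(v)`, plus `f(s_i v)` if `i` is a left descent of `v`. -/
noncomputable def skewStep (i : Fin n) (f : Equiv.Perm (Fin (n + 1)) → FK (n + 1)) :
    Equiv.Perm (Fin (n + 1)) → FK (n + 1) := fun v =>
  (if v⁻¹ i.castSucc < v⁻¹ i.succ then 0 else f (simpleTransposition i * v)) +
    FK.x (v⁻¹ i.castSucc) (v⁻¹ i.succ) * f v

theorem skewStep_of_isLeftAscent {i : Fin n} {v : Equiv.Perm (Fin (n + 1))}
    (h : IsLeftAscent i v) (f : Equiv.Perm (Fin (n + 1)) → FK (n + 1)) :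
    skewStep i f v = FK.x (v⁻¹ i.castSucc) (v⁻¹ i.succ) * f v := by
  rw [skewStep, if_pos (show _ < _ from h), zero_add]

theorem skewStep_of_not_isLeftAscent {i : Fin n} {v : Equiv.Perm (Fin (n + 1))}
    (h : ¬ IsLeftAscent i v) (f : Equiv.Perm (Fin (n + 1)) → FK (n + 1)) :
    skewStep i f v =
      f (simpleTransposition i * v) + FK.x (v⁻¹ i.castSucc) (v⁻¹ i.succ) * f v := by
  rw [skewStep, if_neg (show ¬ _ < _ from h)]

theorem skewStep_comm {i j : Fin n} (hij : (i : ℕ) + 1 < j)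
    (f : Equiv.Perm (Fin (n + 1)) → FK (n + 1)) :
    skewStep i (skewStep j f) = skewStep j (skewStep i f) := by
  obtain ⟨s1, s2, s3, s4⟩ := simpleTransposition_apply_of_lt hij
  have hc : ∀ v, simpleTransposition j * (simpleTransposition i * v) =
      simpleTransposition i * (simpleTransposition j * v) := fun v => by
    rw [← mul_assoc, ← simpleTransposition_commute hij, mul_assoc]
  funext v
  have hx : ∀ c, FK.x (v⁻¹ i.castSucc) (v⁻¹ i.succ) * (FK.x (v⁻¹ j.castSucc) (v⁻¹ j.succ) * c) =
      FK.x (v⁻¹ j.castSucc) (v⁻¹ j.succ) * (FK.x (v⁻¹ i.castSucc) (v⁻¹ i.succ) * c) := by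
    intro c
    rw [← mul_assoc, ← mul_assoc]
    congr 1
    apply FK.x_comm <;> simp [Fin.ext_iff] <;> omega
  simp only [skewStep, mul_inv_rev, simpleTransposition_inv, Equiv.Perm.mul_apply,
    s1, s2, s3, s4, hc, mul_add, hx]
  split_ifs <;> (try simp only [mul_zero, zero_add])
  all_goals abel

theorem skewStep_braid {i j : Fin n} (hij : i.succ = j.castSucc)
    (f : Equiv.Perm (Fin (n + 1)) → FK (n + 1)) :
    skewStep i (skewStep j (skewStep i f)) = skewStep j (skewStep i (skewStep j f)) := by
  obtain ⟨s1, s2⟩ := simpleTransposition_apply_of_succ hij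
  have s3 : simpleTransposition j i.succ = j.succ := by rw [hij, simpleTransposition_castSucc]
  have s4 : simpleTransposition i i.succ = i.castSucc := simpleTransposition_succ i
  have hc : ∀ v, simpleTransposition j * (simpleTransposition i * (simpleTransposition j * v)) =
      simpleTransposition i * (simpleTransposition j * (simpleTransposition i * v)) := fun v => by
    simpa only [mul_assoc] using congrArg (· * v) (simpleTransposition_braid hij).symm
  funext v
  have hpq : v⁻¹ i.castSucc ≠ v⁻¹ i.succ := by simp [Fin.ext_iff]
  have hqr : v⁻¹ i.succ ≠ v⁻¹ j.succ := by rw [hij]; simp [Fin.ext_iff]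
  have hpr : v⁻¹ i.castSucc ≠ v⁻¹ j.succ := by
    rw [Fin.ext_iff, Fin.val_succ, Fin.val_castSucc] at hij
    simp [Fin.ext_iff]; omega
  simp only [skewStep, mul_inv_rev, simpleTransposition_inv, Equiv.Perm.mul_apply,
    s1, s2, s3, s4, ← hij, hc, simpleTransposition_castSucc, simpleTransposition_succ,
    simpleTransposition_mul_cancel_left]
  -- Which terms survive depends only on the relative order of the three positions.
  generalize v⁻¹ i.castSucc = p at *
  generalize v⁻¹ i.succ = q at *
  generalize v⁻¹ j.succ = r at *
  have e1 : ∀ c, FK.x p q * (FK.x q r * (FK.x p q * c)) = FK.x q r * (FK.x p q * (FK.x q r * c)) :=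
    fun c => by simpa only [mul_assoc] using congrArg (· * c) (FK.x_braid hpq hqr hpr)
  have e2 : ∀ c, FK.x q r * (FK.x p r * c) = FK.x p q * (FK.x q r * c) + FK.x p r * (FK.x q p * c) :=
    fun c => by
      simpa only [mul_assoc, add_mul] using congrArg (· * c) (FK.x_mul_x_add hpq hqr hpr).symm
  have e3 : ∀ c, FK.x p q * (FK.x p r * c) = FK.x p r * (FK.x r q * c) + FK.x q r * (FK.x p q * c) :=
    fun c => by
      simpa only [mul_assoc, add_mul] using congrArg (· * c) (FK.x_mul_x_of_left hpq hqr hpr)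
  -- Two of the eight sign patterns contradict transitivity. In the six genuine orders, the
  -- coefficients of each value of `f` match by the cubic relation `e1` and the quadratic relations
  -- `e2`, `e3`.
  set_option linter.unusedSimpArgs false in
  rcases lt_or_gt_of_ne hpq with h1 | h1 <;> rcases lt_or_gt_of_ne hqr with h2 | h2 <;>
    rcases lt_or_gt_of_ne hpr with h3 | h3 <;>
    first
    | exact absurd (h1.trans h2) h3.not_gt
    | (simp only [h1, h2, h3, h1.not_gt, h2.not_gt, h3.not_gt, if_true, if_false, zero_add, mul_add,
        add_zero, mul_zero, e1, e2, e3]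
       try ac_rfl)

end

/-! ### Sums over subwords, and the recursion for skew elements. -/

section

variable {n : ℕ}

theorem sum_finset_fin_succ {M : Type*} [AddCommMonoid M] {m : ℕ}
    (F : Finset (Fin (m + 1)) → M) :
    ∑ J, F J = ∑ J : Finset (Fin m), F (J.map (Fin.succEmb m)) +
      ∑ J : Finset (Fin m), F (insert 0 (J.map (Fin.succEmb m))) := by
  classical
  rw [← Finset.powerset_univ, Fin.univ_succ, Finset.cons_eq_insert,
    Finset.sum_powerset_insert (by simp)]
  have h : ((Finset.univ : Finset (Fin m)).map (Fin.succEmb m)).powerset =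
      Finset.univ.map (Finset.mapEmbedding (Fin.succEmb m)).toEmbedding := by
    ext T
    simp [Finset.subset_map_iff, eq_comm]
  change ∑ t ∈ (Finset.univ.map (Fin.succEmb m)).powerset, _ +
    ∑ t ∈ (Finset.univ.map (Fin.succEmb m)).powerset, _ = _
  rw [h, Finset.sum_map, Finset.sum_map]
  rfl

/-- The preceding splitting, in a form whose index type matches positions in `i :: a` syntactically.
-/
theorem sum_finset_fin_length_cons {M α : Type*} [AddCommMonoid M] (i : α) (a : List α)
    (F : Finset (Fin (i :: a).length) → M) :
    ∑ J, F J = ∑ J : Finset (Fin a.length), F (J.map (Fin.succEmb _)) +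
      ∑ J : Finset (Fin a.length), F (insert 0 (J.map (Fin.succEmb _))) :=
  sum_finset_fin_succ F

theorem succ_mem_insert_zero_map {m : ℕ} {J : Finset (Fin m)} {k : Fin m} :
    k.succ ∈ insert 0 (J.map (Fin.succEmb m)) ↔ k ∈ J := by
  simp [Fin.succ_ne_zero]

theorem succ_mem_map {m : ℕ} {J : Finset (Fin m)} {k : Fin m} :
    k.succ ∈ J.map (Fin.succEmb m) ↔ k ∈ J := by
  simp

theorem zero_notMem_map {m : ℕ} {J : Finset (Fin m)} :
    (0 : Fin (m + 1)) ∉ J.map (Fin.succEmb m) := by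
  simp [Fin.succ_ne_zero]

theorem subword_cons_map (i : Fin n) (a : List (Fin n)) (J : Finset (Fin a.length)) :
    subword (i :: a) (J.map (Fin.succEmb _)) = subword a J := by
  simp only [subword, List.length_cons, List.finRange_succ]
  rw [List.filter_cons_of_neg (by simp), List.filter_map, List.map_map]
  simp only [Function.comp_def, succ_mem_map]
  rfl

theorem subword_cons_insert (i : Fin n) (a : List (Fin n)) (J : Finset (Fin a.length)) :
    subword (i :: a) (insert 0 (J.map (Fin.succEmb _))) = i :: subword a J := by
  simp only [subword, List.length_cons, List.finRange_succ]
  rw [List.filter_cons_of_pos (by simp), List.filter_map, List.map_cons, List.map_map]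
  simp only [Function.comp_def, succ_mem_insert_zero_map]
  rfl

theorem phi_cons_map (i : Fin n) (a : List (Fin n)) (J : Finset (Fin a.length)) :
    phi (i :: a) (J.map (Fin.succEmb _)) =
      SkewMonoidAlgebra.single 1 (FK.x i.castSucc i.succ) * phi a J := by
  simp only [phi, List.length_cons, List.finRange_succ, List.map_cons, List.prod_cons,
    List.map_map]
  rw [if_neg zero_notMem_map]
  simp only [Function.comp_def, succ_mem_map]
  rfl

theorem phi_cons_insert (i : Fin n) (a : List (Fin n)) (J : Finset (Fin a.length)) :
    phi (i :: a) (insert 0 (J.map (Fin.succEmb _))) =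
      SkewMonoidAlgebra.single (simpleTransposition i) 1 * phi a J := by
  simp only [phi, List.length_cons, List.finRange_succ, List.map_cons, List.prod_cons,
    List.map_map]
  rw [if_pos (Finset.mem_insert_self _ _)]
  simp only [Function.comp_def, succ_mem_insert_zero_map]
  rfl

theorem yProd_cons_map (i : Fin n) (a : List (Fin n)) (J : Finset (Fin a.length)) :
    yProd (i :: a) (J.map (Fin.succEmb _)) =
      (wordProd a)⁻¹ • FK.x i.castSucc i.succ * yProd a J := by
  simp only [yProd, List.length_cons, List.finRange_succ]
  rw [List.filter_cons_of_pos (by simp), List.filter_map, List.map_cons,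
    List.prod_cons, List.map_map]
  simp only [Function.comp_def, succ_mem_map]
  rfl

theorem yProd_cons_insert (i : Fin n) (a : List (Fin n)) (J : Finset (Fin a.length)) :
    yProd (i :: a) (insert 0 (J.map (Fin.succEmb _))) = yProd a J := by
  simp only [yProd, List.length_cons, List.finRange_succ]
  rw [List.filter_cons_of_neg (by simp), List.filter_map, List.map_map]
  simp only [Function.comp_def, succ_mem_insert_zero_map]
  rfl

open Classical in
/-- The sum of `F J` over the sets of positions `J` at which `a` carries a reduced word for `v`. -/
noncomputable def subwordSum {M : Type*} [AddCommMonoid M] (a : List (Fin n))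
    (v : Equiv.Perm (Fin (n + 1))) (F : Finset (Fin a.length) → M) : M :=
  ∑ J ∈ Finset.univ.filter (fun J : Finset (Fin a.length) => IsReducedWord (subword a J) v), F J

/-- No reduced word of `v` starts with a left ascent, so position 0 is never chosen. -/
theorem subwordSum_cons_of_isLeftAscent {M : Type*} [AddCommMonoid M] {i : Fin n}
    (a : List (Fin n)) {v : Equiv.Perm (Fin (n + 1))} (h : IsLeftAscent i v)
    (F : Finset (Fin (i :: a).length) → M) :
    subwordSum (i :: a) v F = subwordSum a v (fun J => F (J.map (Fin.succEmb _))) := by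
  classical
  simp only [subwordSum, Finset.sum_filter]
  rw [sum_finset_fin_length_cons]
  simp only [subword_cons_insert, isReducedWord_cons, h, not_true_eq_false, false_and, if_false,
    Finset.sum_const_zero, add_zero]
  exact Finset.sum_congr rfl fun J _ =>
    if_congr (iff_of_eq (congrArg (IsReducedWord · v) (subword_cons_map i a J))) rfl rfl

theorem subwordSum_cons_of_not_isLeftAscent {M : Type*} [AddCommMonoid M] {i : Fin n}
    (a : List (Fin n)) {v : Equiv.Perm (Fin (n + 1))} (h : ¬ IsLeftAscent i v)
    (F : Finset (Fin (i :: a).length) → M) :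
    subwordSum (i :: a) v F = subwordSum a v (fun J => F (J.map (Fin.succEmb _))) +
      subwordSum a (simpleTransposition i * v)
        (fun J => F (insert 0 (J.map (Fin.succEmb _)))) := by
  classical
  simp only [subwordSum, Finset.sum_filter]
  rw [sum_finset_fin_length_cons]
  refine congrArg₂ _ (Finset.sum_congr rfl fun J _ => if_congr ?_ rfl rfl)
    (Finset.sum_congr rfl fun J _ => if_congr ?_ rfl rfl)
  · exact iff_of_eq (congrArg (IsReducedWord · v) (subword_cons_map i a J))
  · exact (iff_of_eq (congrArg (IsReducedWord · v) (subword_cons_insert i a J))).trans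
      (isReducedWord_cons.trans (and_iff_right h))

theorem mul_subwordSum {M : Type*} [NonUnitalNonAssocSemiring M] (a : List (Fin n))
    (v : Equiv.Perm (Fin (n + 1))) (F : Finset (Fin a.length) → M) (c : M) :
    subwordSum a v (fun J => c * F J) = c * subwordSum a v F := by
  rw [subwordSum, subwordSum, Finset.mul_sum]

/-- With the prefactor `v⁻¹` cleared, the first factor of each `phi` can be pulled out of the sum;
`skew_cons` is proved in this form. -/
theorem subwordSum_phi (a : List (Fin n)) (v : Equiv.Perm (Fin (n + 1))) :
    subwordSum a v (phi a) = SkewMonoidAlgebra.single v (v • skew a v) := by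
  have h := single_one_skew a v
  have h2 : SkewMonoidAlgebra.single v 1 * skewSum a v = subwordSum a v (phi a) := by
    rw [skewSum, ← mul_assoc, SkewMonoidAlgebra.single_mul_single, mul_inv_cancel, smul_one,
      mul_one, SkewMonoidAlgebra.single_one_one, one_mul]
    rfl
  rw [← h2, ← h, SkewMonoidAlgebra.single_mul_single, mul_one, one_mul]

theorem skew_cons (i : Fin n) (a : List (Fin n)) : skew (i :: a) = skewStep i (skew a) := by
  funext v
  have hx : v • (FK.x (v⁻¹ i.castSucc) (v⁻¹ i.succ) * skew a v) =
      FK.x i.castSucc i.succ * v • skew a v := by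
    rw [smul_mul', FK.smul_x]
    simp
  refine MulAction.injective v (SkewMonoidAlgebra.single_injective v ?_)
  dsimp only
  rw [← subwordSum_phi]
  by_cases h : IsLeftAscent i v
  · rw [subwordSum_cons_of_isLeftAscent _ h, skewStep_of_isLeftAscent h]
    simp only [phi_cons_map]
    rw [mul_subwordSum, subwordSum_phi, SkewMonoidAlgebra.single_mul_single, hx, one_mul, one_smul]
  · rw [subwordSum_cons_of_not_isLeftAscent _ h, skewStep_of_not_isLeftAscent h]
    simp only [phi_cons_map, phi_cons_insert]
    rw [mul_subwordSum, mul_subwordSum, subwordSum_phi, subwordSum_phi,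
      SkewMonoidAlgebra.single_mul_single, SkewMonoidAlgebra.single_mul_single, smul_add, hx,
      one_mul, one_smul, one_mul, smul_smul, simpleTransposition_mul_cancel_left,
      ← SkewMonoidAlgebra.single_add]
    exact congrArg _ (add_comm _ _)

open Classical in
theorem skew_nil (v : Equiv.Perm (Fin (n + 1))) : skew [] v = if v = 1 then 1 else 0 := by
  have h := subwordSum_phi [] v
  refine MulAction.injective v (SkewMonoidAlgebra.single_injective v ?_)
  dsimp only
  rw [← h, subwordSum]
  have h1 (J) : subword ([] : List (Fin n)) J = [] := rfl
  have h2 (J) : phi ([] : List (Fin n)) J = 1 := rfl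
  simp only [h1, h2, isReducedWord_nil]
  split_ifs with hv
  · subst hv
    simp [SkewMonoidAlgebra.single_one_one]
  · simp [hv]

theorem skew_eq_foldr (a : List (Fin n)) : skew a = a.foldr skewStep (skew []) := by
  induction a with
  | nil => rfl
  | cons i a ih => rw [skew_cons, ih, List.foldr_cons]

/-- The skew elements of a reduced word depend only on its product. -/
theorem skew_eq_skew {a b : List (Fin n)} {w : Equiv.Perm (Fin (n + 1))} (ha : IsReducedWord a w)
    (hb : IsReducedWord b w) : skew a = skew b := by
  rw [skew_eq_foldr a, skew_eq_foldr b]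
  exact foldr_eq_foldr_of_isReducedWord skewStep (fun _ _ h f => skewStep_comm h f)
    (fun _ _ h f => skewStep_braid h f) ha hb _

/-- The word has too few letters to contain a reduced word of `v`. -/
theorem skew_eq_zero_of_length_lt {a : List (Fin n)} {v : Equiv.Perm (Fin (n + 1))}
    (h : a.length < (inversions v).card) : skew a v = 0 := by
  induction a generalizing v with
  | nil =>
    rw [skew_nil, if_neg]
    rintro rfl
    simp [inversions_one] at h
  | cons i a ih =>
    rw [List.length_cons] at h
    rw [skew_cons]
    by_cases hi : IsLeftAscent i v
    · rw [skewStep_of_isLeftAscent hi, ih (by omega), mul_zero]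
    · have := card_inversions_of_not_isLeftAscent hi
      rw [skewStep_of_not_isLeftAscent hi, ih (by omega), ih (by omega), mul_zero, add_zero]

open Classical in
-- Only the set of all positions can contribute, and its term contains no variable.
theorem skew_of_length_eq {a : List (Fin n)} {v : Equiv.Perm (Fin (n + 1))}
    (h : a.length = (inversions v).card) : skew a v = if wordProd a = v then 1 else 0 := by
  induction a generalizing v with
  | nil => rw [skew_nil, wordProd_nil]; simp only [eq_comm]
  | cons i a ih =>
    rw [List.length_cons] at h
    rw [skew_cons]
    have hw : wordProd (i :: a) = v ↔ wordProd a = simpleTransposition i * v := by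
      rw [wordProd_cons]
      constructor
      · rintro rfl; simp
      · intro h; simp [h]
    by_cases hi : IsLeftAscent i v
    · rw [skewStep_of_isLeftAscent hi, skew_eq_zero_of_length_lt (by omega), mul_zero, if_neg]
      rw [hw]
      intro he
      have h1 := card_inversions_wordProd_le a
      have h2 := card_inversions_of_isLeftAscent hi
      rw [he] at h1
      omega
    · have := card_inversions_of_not_isLeftAscent hi
      rw [skewStep_of_not_isLeftAscent hi, ih (by omega), skew_eq_zero_of_length_lt (a := a)
        (by omega), mul_zero, add_zero]
      simp only [hw]

end

/-! ### The upward recursion in `v` and the comparison with subwords of `b`. -/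

section

variable {n : ℕ}

/-- This is `skew_cons` at `simpleTransposition j * v`, where `j` is a left descent, solved for
`skew a v`; the sign comes from antisymmetry. The word `j :: a` need not be reduced. -/
theorem skew_of_isLeftAscent {j : Fin n} {v : Equiv.Perm (Fin (n + 1))}
    {a : List (Fin n)} (hv : IsLeftAscent j v) :
    skew a v = skew (j :: a) (simpleTransposition j * v) +
      FK.x (v⁻¹ j.castSucc) (v⁻¹ j.succ) * skew a (simpleTransposition j * v) := by
  have hne : v⁻¹ j.succ ≠ v⁻¹ j.castSucc := (show _ < _ from hv).ne'
  rw [skew_cons, skewStep_of_not_isLeftAscent (by simpa only [isLeftAscent_simple_mul, not_not]),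
    simpleTransposition_mul_cancel_left, mul_inv_rev, simpleTransposition_inv,
    Equiv.Perm.mul_apply, Equiv.Perm.mul_apply, simpleTransposition_castSucc,
    simpleTransposition_succ, add_assoc, ← add_mul, FK.x_add_x_swap hne, zero_mul, add_zero]

/-- By independence of the reduced word, `a` may be taken to start with `j`. Expanding both sides,
the extra term on the right contains `x_{pq} x_{qp} = 0`. -/
theorem skew_of_isLeftAscent_of_not_isLeftAscent {j : Fin n} {v w : Equiv.Perm (Fin (n + 1))}
    {a : List (Fin n)} (ha : IsReducedWord a w) (hv : IsLeftAscent j v) (hw : ¬ IsLeftAscent j w) :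
    skew a v = FK.x (v⁻¹ j.castSucc) (v⁻¹ j.succ) * skew a (simpleTransposition j * v) := by
  have hne : v⁻¹ j.castSucc ≠ v⁻¹ j.succ := (show _ < _ from hv).ne
  obtain ⟨c, hc⟩ := exists_isReducedWord (simpleTransposition j * w)
  rw [skew_eq_skew ha (isReducedWord_cons.2 ⟨hw, hc⟩), skew_cons, skewStep_of_isLeftAscent hv,
    skewStep_of_not_isLeftAscent (by simpa only [isLeftAscent_simple_mul, not_not]),
    simpleTransposition_mul_cancel_left, mul_inv_rev, simpleTransposition_inv,
    Equiv.Perm.mul_apply, Equiv.Perm.mul_apply, simpleTransposition_castSucc,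
    simpleTransposition_succ, mul_add, ← mul_assoc (FK.x _ _) (FK.x _ _), FK.x_mul_x_swap hne,
    zero_mul, add_zero]

theorem longestPerm_inv_apply (x : Fin (n + 1)) : (longestPerm n)⁻¹ x = x.rev := rfl

theorem longestPerm_mul_self : longestPerm n * longestPerm n = 1 := by
  ext x
  simp [longestPerm]

theorem simpleTransposition_mul_longestPerm (i : Fin n) :
    simpleTransposition i * longestPerm n = longestPerm n * simpleTransposition i.rev := by
  have h := Equiv.swap_mul_eq_mul_swap (longestPerm n) i.castSucc i.succ
  rwa [longestPerm_inv_apply, longestPerm_inv_apply, Fin.rev_castSucc, Fin.rev_succ,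
    Equiv.swap_comm i.rev.succ] at h

theorem isLeftAscent_longestPerm_mul {i : Fin n} {v : Equiv.Perm (Fin (n + 1))} :
    IsLeftAscent i (longestPerm n * v) ↔ ¬ IsLeftAscent i.rev v := by
  rw [not_isLeftAscent, IsLeftAscent, mul_inv_rev, Equiv.Perm.mul_apply, Equiv.Perm.mul_apply,
    longestPerm_inv_apply, longestPerm_inv_apply, Fin.rev_castSucc, Fin.rev_succ]

theorem inversions_subset_inversions_longestPerm (w : Equiv.Perm (Fin (n + 1))) :
    inversions w ⊆ inversions (longestPerm n) := by
  intro p hp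
  rw [mem_inversions] at hp ⊢
  exact ⟨hp.1, Fin.rev_lt_rev.2 hp.1⟩

theorem skew_longestPerm {w : Equiv.Perm (Fin (n + 1))} {a : List (Fin n)}
    (ha : IsReducedWord a w) [Decidable (longestPerm n * w = 1)] :
    skew a (longestPerm n) = if longestPerm n * w = 1 then 1 else 0 := by
  classical
  have ha' := isReducedWord_iff.1 ha
  have hw : longestPerm n * w = 1 ↔ w = longestPerm n := by
    rw [← longestPerm_mul_self, mul_right_inj]
  rcases (Finset.card_le_card (inversions_subset_inversions_longestPerm w)).lt_or_eq with h | h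
  · rw [skew_eq_zero_of_length_lt (ha'.2 ▸ h), if_neg]
    rw [hw]
    rintro rfl
    exact h.ne rfl
  · rw [skew_of_length_eq (ha'.2.trans h), ha'.1]
    simp only [hw]

theorem skew_eq_subwordSum_yProd {v w : Equiv.Perm (Fin (n + 1))} {a b : List (Fin n)}
    (ha : IsReducedWord a w) (hb : IsReducedWord b (longestPerm n * v)) :
    skew a v = subwordSum b (longestPerm n * w) (yProd b) := by
  classical
  induction b generalizing v w a with
  | nil =>
    rw [isReducedWord_nil, ← longestPerm_mul_self, mul_right_inj] at hb
    subst hb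
    rw [skew_longestPerm ha, subwordSum]
    have h1 (J) : subword ([] : List (Fin n)) J = [] := rfl
    have h2 (J) : yProd ([] : List (Fin n)) J = 1 := rfl
    simp only [h1, h2, isReducedWord_nil]
    split_ifs with hw <;> simp [hw]
  | cons i b ih =>
    -- Removing the first letter `i` of `b` replaces `v` by `s v`, where `s` is the simple
    -- transposition of index `i.rev`.
    rw [isReducedWord_cons, isLeftAscent_longestPerm_mul, not_not, ← mul_assoc,
      simpleTransposition_mul_longestPerm, mul_assoc] at hb
    obtain ⟨hv, hb⟩ := hb
    have hy : (wordProd b)⁻¹ • FK.x i.castSucc i.succ =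
        FK.x (v⁻¹ i.rev.castSucc) (v⁻¹ i.rev.succ) := by
      rw [hb.1, FK.smul_x, mul_inv_rev, mul_inv_rev, simpleTransposition_inv]
      simp only [Equiv.Perm.mul_apply, longestPerm_inv_apply, Fin.rev_castSucc, Fin.rev_succ,
        simpleTransposition_castSucc, simpleTransposition_succ]
    by_cases hw : IsLeftAscent i.rev w
    -- Skipping `i` contributes `y_0` and keeps `w`; using `i` replaces `w` by `s w`, for which
    -- `i.rev :: a` is a reduced word.
    · rw [subwordSum_cons_of_not_isLeftAscent _ (by rwa [isLeftAscent_longestPerm_mul, not_not])]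
      simp only [yProd_cons_map, yProd_cons_insert]
      rw [mul_subwordSum, hy, ← mul_assoc, simpleTransposition_mul_longestPerm, mul_assoc,
        ← ih ha hb, ← ih (ha.cons hw) hb, skew_of_isLeftAscent hv]
      exact add_comm _ _
    · rw [subwordSum_cons_of_isLeftAscent _ (by rwa [isLeftAscent_longestPerm_mul])]
      simp only [yProd_cons_map]
      rw [mul_subwordSum, hy, ← ih ha hb, skew_of_isLeftAscent_of_not_isLeftAscent ha hv hw]

/-! ### Positivity and distinctness of the variables `y_k`. -/

/-- The pair of indices of the variable `y_k`. -/
def yPair (b : List (Fin n)) (k : Fin b.length) : Fin (n + 1) × Fin (n + 1) :=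
  ((wordProd (b.drop (k + 1)))⁻¹ (b.get k).castSucc, (wordProd (b.drop (k + 1)))⁻¹ (b.get k).succ)

theorem yVar_eq (b : List (Fin n)) (k : Fin b.length) :
    yVar b k = FK.x (yPair b k).1 (yPair b k).2 :=
  FK.smul_x _ _ _

/-- Building `w` from the right end of `b`, each letter creates one inversion, and `yPair b k` is
the one created by letter `k`. -/
theorem yPair_mem_inversions {b : List (Fin n)} {w : Equiv.Perm (Fin (n + 1))}
    (hb : IsReducedWord b w) (k : Fin b.length) : yPair b k ∈ inversions w := by
  induction b generalizing w with
  | nil => exact k.elim0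
  | cons i b ih =>
    obtain ⟨hi, hb⟩ := isReducedWord_cons.1 hb
    have h := inversions_simple_mul (isLeftAscent_simple_mul.2 hi)
    rw [simpleTransposition_mul_cancel_left] at h
    rw [h, Finset.mem_insert, ← hb.1]
    refine Fin.cases (Or.inl rfl) (fun k => Or.inr ?_) k
    rw [hb.1]
    exact ih hb k

theorem yPair_injective {b : List (Fin n)} {w : Equiv.Perm (Fin (n + 1))}
    (hb : IsReducedWord b w) : Function.Injective (yPair b) := by
  induction b generalizing w with
  | nil => exact fun k => k.elim0
  | cons i b ih =>
    obtain ⟨hi, hb⟩ := isReducedWord_cons.1 hb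
    -- The pair of the first letter is not an inversion of the product of the tail, whereas all
    -- later pairs are.
    have h0 (k : Fin b.length) : yPair (i :: b) 0 ≠ yPair b k := by
      have h1 : yPair (i :: b) 0 ∉ inversions (wordProd b) :=
        inv_castSucc_inv_succ_notMem_inversions i (wordProd b)
      rw [hb.1] at h1
      exact fun h => h1 (h ▸ yPair_mem_inversions hb k)
    intro k l
    refine Fin.cases ?_ (fun k => ?_) k <;> refine Fin.cases ?_ (fun l => ?_) l
    · exact fun _ => rfl
    · exact fun h => absurd h (h0 l)
    · exact fun h => absurd h.symm (h0 k)
    · exact fun h => congrArg Fin.succ (ih hb h)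

theorem yVar_mem_positive {b : List (Fin n)} {w : Equiv.Perm (Fin (n + 1))}
    (hb : IsReducedWord b w) (k : Fin b.length) : yVar b k ∈ FK.positive (n + 1) :=
  Submodule.subset_span (Submonoid.subset_closure
    ⟨_, _, (mem_inversions.1 (yPair_mem_inversions hb k)).1, yVar_eq b k⟩)

theorem yProd_mem_positiveNoRepeat {b : List (Fin n)} {w : Equiv.Perm (Fin (n + 1))}
    (hb : IsReducedWord b w) (J : Finset (Fin b.length)) :
    yProd b J ∈ FK.positiveNoRepeat (n + 1) := by
  refine Submodule.subset_span ⟨((List.finRange b.length).filter (· ∉ J)).map (yPair b),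
    ((List.nodup_finRange _).filter _).map (yPair_injective hb), ?_, ?_⟩
  · intro p hp
    obtain ⟨k, -, rfl⟩ := List.mem_map.1 hp
    exact (mem_inversions.1 (yPair_mem_inversions hb k)).1
  · rw [List.map_map, yProd]
    exact congrArg List.prod (List.map_congr_left fun k _ => yVar_eq b k)

end

open Classical in
theorem corollary3p6 (n : ℕ) (v w : Equiv.Perm (Fin (n + 1)))
    (a : List (Fin n)) (ha : IsReducedWord a w)
    (b : List (Fin n)) (hb : IsReducedWord b (longestPerm n * v)) :
    (∀ k : Fin b.length, yVar b k ∈ FK.positive (n + 1)) ∧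
    skew a v = ∑ J ∈ Finset.univ.filter
        (fun J : Finset (Fin b.length) => IsReducedWord (subword b J) (longestPerm n * w)),
      yProd b J ∧
    skew a v ∈ FK.positiveNoRepeat (n + 1) := by
  have h := skew_eq_subwordSum_yProd ha hb
  refine ⟨yVar_mem_positive hb, h, ?_⟩
  rw [h, subwordSum]
  exact Submodule.sum_mem _ fun J _ => yProd_mem_positiveNoRepeat hb J
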